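/- Let $R_1=\mathbb F_2[z,\frac1{z(1+z)}]$ and let $\mathfrak O_1=R_1\oplus R_1 I\oplus R_1 J\oplus R_1 IJ$ be the $R_1$-algebra with multiplication determined by $I^2+I=z$, $J^2=1+z^3$, $IJ=J(I+1)$ (an order in the quaternion algebra $\bigl[\frac{z,\,1+z^3}{\mathbb F_2(z)}\bigr)$). The elements \[ C_1=1+z^2+IJ,\quad C_2=z+z^2+IJ,\quad B_1=(1+z)I+J,\quad B_2=z+z^2+(1+z)I+J+IJ \] are invertible in $\mathfrak O_1$; let $c_1,c_2,b_1,b_2$ be their images in the group $G(R_1)=\mathfrak O_1^\times/R_1^\times$. Let $\Gamma=\langle a_1,a_2\rangle\le G(R_1)$ be the subgroup generated by $a_1=c_1b_1^{-1}$ and $a_2=c_2b_2^{-1}$. Then the abelianization $\Gamma^{\mathrm{ab}}$ is isomorphic to $\mathbb Z/15\mathbb Z$. -/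

import Mathlib

namespace QuatLattice

/-- The ring `R₁ = 𝔽₂[z, 1 / (z (1 + z))]`. -/
noncomputable abbrev R1 : Type :=
  Localization.Away
    ((Polynomial.X : Polynomial (ZMod 2)) * (1 + (Polynomial.X : Polynomial (ZMod 2))))

/-- The element `z` of `R₁`. -/
noncomputable def z : R1 :=
  algebraMap (Polynomial (ZMod 2)) R1 Polynomial.X

/-- The `R₁`-order `𝔒₁ = R₁ ⊕ R₁ I ⊕ R₁ J ⊕ R₁ I J`, where `I ^ 2 = z + I`, `J ^ 2 = 1 + z ^ 3`
and `J I = J - I J` (that is, `I J = J (I + 1)`, since `2 = 0`).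
The components `re`, `imI`, `imJ`, `imK` are the coordinates with respect to `1`, `I`, `J`, `I J`;
see `I_relation`, `J_relation`, `IJ_relation` and `basis_expansion` below. -/
noncomputable abbrev O1 : Type := QuaternionAlgebra R1 z 1 (1 + z ^ 3)

/-- The quaternion `I`. -/
noncomputable def I : O1 := ⟨0, 1, 0, 0⟩

/-- The quaternion `J`. -/
noncomputable def J : O1 := ⟨0, 0, 1, 0⟩

theorem two_eq_zero : (2 : R1) = 0 := by
  have h : (2 : Polynomial (ZMod 2)) = 0 := CharTwo.two_eq_zero
  have h2 := congrArg (algebraMap (Polynomial (ZMod 2)) R1) h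
  rwa [map_ofNat, map_zero] at h2

theorem add_self_zero (x : R1) : x + x = 0 := by
  linear_combination x * two_eq_zero

theorem I_relation : I ^ 2 + I = algebraMap R1 O1 z := by
  rw [pow_two]
  ext <;> simp [I, QuaternionAlgebra.algebraMap_eq, add_self_zero]

theorem J_relation : J ^ 2 = algebraMap R1 O1 (1 + z ^ 3) := by
  rw [pow_two]
  ext <;> simp [J, QuaternionAlgebra.algebraMap_eq]

theorem IJ_relation : I * J = J * (I + 1) := by
  ext <;> simp [I, J]
  · linear_combination -two_eq_zero
  · linear_combination two_eq_zero

theorem basis_expansion (q : O1) :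
    q = q.re • (1 : O1) + q.imI • I + q.imJ • J + q.imK • (I * J) := by
  ext <;> simp [I, J]

/-- The quaternion `C₁ = 1 + z² + I J`. -/
noncomputable def C1 : O1 := algebraMap R1 O1 (1 + z ^ 2) + I * J

/-- The quaternion `C₂ = z + z² + I J`. -/
noncomputable def C2 : O1 := algebraMap R1 O1 (z + z ^ 2) + I * J

/-- The quaternion `B₁ = (1 + z) I + J`. -/
noncomputable def B1 : O1 := (1 + z) • I + J

/-- The quaternion `B₂ = z + z² + (1 + z) I + J + I J`. -/
noncomputable def B2 : O1 := algebraMap R1 O1 (z + z ^ 2) + (1 + z) • I + J + I * J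

theorem isUnit_z_mul : IsUnit (z * (1 + z)) := by
  have h := IsLocalization.Away.algebraMap_isUnit (S := R1)
    ((Polynomial.X : Polynomial (ZMod 2)) * (1 + (Polynomial.X : Polynomial (ZMod 2))))
  rwa [map_mul, map_add, map_one] at h

theorem isUnit_one_add_z : IsUnit (1 + z) := isUnit_of_mul_isUnit_right isUnit_z_mul

/-- A quaternion whose reduced norm `q * star q` is a unit of `R₁` is invertible. -/
theorem isUnit_of_norm (q : O1) (n : R1) (hn : IsUnit n)
    (h1 : q * star q = algebraMap R1 O1 n) (h2 : star q * q = algebraMap R1 O1 n) :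
    IsUnit q := by
  have hu : IsUnit (algebraMap R1 O1 n) := hn.map _
  have hl : IsUnit (q * star q) := h1 ▸ hu
  have hc : Commute q (star q) := h1.trans h2.symm
  exact (hc.isUnit_mul_iff.mp hl).1

theorem isUnit_C1 : IsUnit C1 := by
  refine isUnit_of_norm C1 (1 + z) isUnit_one_add_z ?_ ?_ <;> ext <;>
    simp [C1, I, J, QuaternionAlgebra.algebraMap_eq] <;>
    linear_combination (z ^ 4 + z ^ 2) * two_eq_zero

theorem isUnit_C2 : IsUnit C2 := by
  refine isUnit_of_norm C2 (z * (1 + z)) isUnit_z_mul ?_ ?_ <;> ext <;>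
    simp [C2, I, J, QuaternionAlgebra.algebraMap_eq] <;>
    linear_combination (z ^ 4 + z ^ 3) * two_eq_zero

theorem isUnit_B1 : IsUnit B1 := by
  refine isUnit_of_norm B1 (1 + z) isUnit_one_add_z ?_ ?_ <;> ext <;>
    simp [B1, I, J, QuaternionAlgebra.algebraMap_eq] <;>
    first
    | linear_combination -(z ^ 3 + z ^ 2 + z + 1) * two_eq_zero
    | grind [two_eq_zero]

theorem isUnit_B2 : IsUnit B2 := by
  refine isUnit_of_norm B2 (z * (1 + z)) isUnit_z_mul ?_ ?_ <;> ext <;>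
    simp [B2, I, J, QuaternionAlgebra.algebraMap_eq] <;>
    first
    | linear_combination (z ^ 4 - 1) * two_eq_zero
    | grind [two_eq_zero]

/-- The subgroup `R₁ˣ` of `𝔒₁ˣ`. -/
noncomputable def scalarUnits : Subgroup O1ˣ :=
  (Units.map (algebraMap R1 O1 : R1 →* O1)).range

instance scalarUnits_normal : scalarUnits.Normal := by
  constructor
  rintro _ ⟨r, rfl⟩ g
  refine ⟨r, ?_⟩
  apply Units.ext
  have h : (algebraMap R1 O1 (r : R1)) * (g : O1) = g * algebraMap R1 O1 (r : R1) :=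
    Algebra.commutes _ _
  change algebraMap R1 O1 (r : R1) = g * algebraMap R1 O1 (r : R1) * ((g⁻¹ : O1ˣ) : O1)
  rw [← h, mul_assoc, Units.mul_inv, mul_one]

/-- The group `G(R₁) = 𝔒₁ˣ / R₁ˣ`. -/
noncomputable abbrev GR1 : Type := O1ˣ ⧸ scalarUnits

/-- The image of `C₁` in `G(R₁)`. -/
noncomputable def c1 : GR1 := QuotientGroup.mk isUnit_C1.unit

/-- The image of `C₂` in `G(R₁)`. -/
noncomputable def c2 : GR1 := QuotientGroup.mk isUnit_C2.unit

/-- The image of `B₁` in `G(R₁)`. -/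
noncomputable def b1 : GR1 := QuotientGroup.mk isUnit_B1.unit

/-- The image of `B₂` in `G(R₁)`. -/
noncomputable def b2 : GR1 := QuotientGroup.mk isUnit_B2.unit

/-- The lattice `Γ = ⟨a₁, a₂⟩ ≤ G(R₁)` with `a₁ = c₁ b₁⁻¹` and `a₂ = c₂ b₂⁻¹`. -/
noncomputable def Gam : Subgroup GR1 := Subgroup.closure {c1 * b1⁻¹, c2 * b2⁻¹}

end QuatLattice

/-!
The elements `C₁ B₁⁻¹` and `C₂ B₂⁻¹` have reduced norm one and coefficients in `𝔽₂[z, 1 / z]`, and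
in characteristic two the only scalar of norm one is `1`; hence `Γ` is isomorphic to the group they
generate inside the norm-one group of the order over `𝔽₂[z, 1 / z]`. Two relations between them
give `a₂ = a₁ ^ 2` and `a₁ ^ 15 = 1` in the abelianization. Conversely, since `1 + z` is not
inverted in `𝔽₂[z, 1 / z]`, one may specialize `z` to `1` in `𝔽₂` and to a primitive cube root of
unity in `𝔽₄`. Both specializations kill `J ^ 2 = 1 + z ^ 3`, so `J` can be divided out, which
leaves the commutative rings `𝔽₂[I]` and `𝔽₄[I]`, in which `a₁` has order `3` and `5`.
-/

namespace QuatLattice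

open LaurentPolynomial
open scoped Polynomial QuadraticAlgebra

section Group

variable {G H : Type*} [Group G] [Group H] {x y : G}

theorem orderOf_map_dvd_orderOf_abelianization {A : Type*} [CommGroup A] (χ : G →* A) (x : G) :
    orderOf (χ x) ∣ orderOf (Abelianization.of x) := by
  rw [← Abelianization.lift_apply_of χ x]
  exact orderOf_map_dvd _ _

theorem zpowers_of_eq_top_of_closure_pair_eq_top (hxy : Subgroup.closure {x, y} = ⊤)
    (hy : Abelianization.of y ∈ Subgroup.zpowers (Abelianization.of x)) :
    Subgroup.zpowers (Abelianization.of x) = ⊤ := by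
  have hle : ⊤ ≤ (Subgroup.zpowers (Abelianization.of x)).comap Abelianization.of := by
    rw [← hxy, Subgroup.closure_le, Set.pair_subset_iff]
    exact ⟨Subgroup.mem_zpowers _, hy⟩
  exact (Subgroup.eq_top_iff' _).2 fun q =>
    QuotientGroup.induction_on q fun g => hle (Subgroup.mem_top g)

theorem closure_pair_subtype_eq_top (x y : G) :
    Subgroup.closure {(⟨x, Subgroup.subset_closure (by simp)⟩ : Subgroup.closure {x, y}),
      ⟨y, Subgroup.subset_closure (by simp)⟩} = ⊤ := by
  rw [← Subgroup.closure_closure_coe_preimage (k := {x, y})]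
  congr 1
  ext g
  simp [Subtype.ext_iff]

/-- Two relations satisfied by the generators `a₁`, `a₂` of the lattice `Γ`; they are not claimed to
present it. -/
structure LatticeRelations (x y : G) : Prop where
  relation_one : y * x * y * x⁻¹ * y * (y * x * y) = x * (y ^ 2)⁻¹ * x⁻¹
  relation_two : x * (y * x * y)⁻¹ * (y⁻¹ * x) ^ 2 * y = x⁻¹ * (y ^ 2)⁻¹ * x

namespace LatticeRelations

theorem map (h : LatticeRelations x y) (f : G →* H) : LatticeRelations (f x) (f y) where
  relation_one := by simpa only [map_mul, map_inv, map_pow] using congrArg f h.relation_one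
  relation_two := by simpa only [map_mul, map_inv, map_pow] using congrArg f h.relation_two

theorem of_map {f : G →* H} (hf : Function.Injective f) (h : LatticeRelations (f x) (f y)) :
    LatticeRelations x y where
  relation_one := hf (by simpa only [map_mul, map_inv, map_pow] using h.relation_one)
  relation_two := hf (by simpa only [map_mul, map_inv, map_pow] using h.relation_two)

section CommGroup

variable {A : Type*} [CommGroup A] {x y : A}

theorem eq_sq (h : LatticeRelations x y) : y = x ^ 2 := by
  have hleft : x * (y * x * y)⁻¹ * (y⁻¹ * x) ^ 2 * y = x ^ 2 * y⁻¹ * (y ^ 2)⁻¹ := by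
    apply Additive.ofMul.injective
    simp only [ofMul_mul, ofMul_inv, ofMul_pow]
    abel
  have h₂ := h.relation_two
  rw [hleft, inv_mul_cancel_comm] at h₂
  exact (mul_inv_eq_one.mp (mul_eq_right.mp h₂)).symm

theorem pow_fifteen_eq_one (h : LatticeRelations x y) : x ^ 15 = 1 := by
  have hleft : y * x * y * x⁻¹ * y * (y * x * y) = x * y ^ 7 * (y ^ 2)⁻¹ := by
    apply Additive.ofMul.injective
    simp only [ofMul_mul, ofMul_inv, ofMul_pow]
    abel
  have h₁ := h.relation_one
  rw [hleft, mul_inv_cancel_comm, mul_eq_right, h.eq_sq, ← pow_mul, ← pow_succ'] at h₁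
  exact h₁

end CommGroup

end LatticeRelations

end Group

section LaurentPolynomial

theorem laurent_eval₂_injective {R S : Type*} [CommRing R] [CommRing S] {f : R →+* S} {x : Sˣ}
    (hf : Function.Injective (Polynomial.eval₂RingHom f (x : S))) :
    Function.Injective (eval₂ f x) := by
  refine (IsLocalization.lift_injective_iff _).2 fun p q => ?_
  rw [algebraMap_eq_toLaurent, algebraMap_eq_toLaurent, Polynomial.toLaurent_inj, hf.eq_iff]

/-- The variable of the Laurent polynomial ring, as a unit. -/
noncomputable def unitT (R : Type*) [CommRing R] : R[T;T⁻¹]ˣ where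
  val := T 1
  inv := T (-1)
  val_inv := by rw [← T_add, add_neg_cancel, T_zero]
  inv_val := by rw [← T_add, neg_add_cancel, T_zero]

theorem eval₂_unitT {R S : Type*} [CommRing R] [CommRing S] (f : R →+* S) (x : Sˣ) :
    eval₂ f x (unitT R : R[T;T⁻¹]) = x := by
  rw [unitT, eval₂_T, zpow_one]

instance charP_laurentPolynomial (R : Type*) [CommRing R] (p : ℕ) [CharP R p] :
    CharP R[T;T⁻¹] p :=
  charP_of_injective_ringHom Polynomial.toLaurent_injective p

theorem X_mul_one_add_X_ne_zero : (Polynomial.X : (ZMod 2)[X]) * (1 + Polynomial.X) ≠ 0 := by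
  refine mul_ne_zero Polynomial.X_ne_zero fun h => ?_
  simpa using congrArg (Polynomial.eval 0) h

theorem algebraMap_R1_injective : Function.Injective (algebraMap (ZMod 2)[X] R1) :=
  IsLocalization.injective R1
    (powers_le_nonZeroDivisors_of_noZeroDivisors X_mul_one_add_X_ne_zero)

instance charP_R1 : CharP R1 2 := charP_of_injective_algebraMap algebraMap_R1_injective 2

theorem isUnit_z : IsUnit z := isUnit_of_mul_isUnit_left isUnit_z_mul

/-- The inclusion `𝔽₂[z, 1 / z] → R₁`. -/
noncomputable def laurentToR1 : (ZMod 2)[T;T⁻¹] →+* R1 :=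
  eval₂ (algebraMap (ZMod 2) R1) isUnit_z.unit

theorem laurentToR1_unitT : laurentToR1 (unitT (ZMod 2) : (ZMod 2)[T;T⁻¹]) = z :=
  eval₂_unitT _ _

theorem laurentToR1_injective : Function.Injective laurentToR1 := by
  refine laurent_eval₂_injective ?_
  convert algebraMap_R1_injective using 2
  ext
  · exact DFunLike.congr_fun (Subsingleton.elim _ _) _
  · simp [z]

end LaurentPolynomial

section QuaternionAlgebra

variable {R S : Type*} [CommRing R] [CommRing S] {a b c : R} {a' b' c' : S}

/-- The change of scalars of a quaternion algebra along a ring homomorphism. -/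
@[simps]
def quaternionMap (f : R →+* S) (ha : f a = a') (hb : f b = b') (hc : f c = c') :
    QuaternionAlgebra R a b c →+* QuaternionAlgebra S a' b' c' where
  toFun q := ⟨f q.re, f q.imI, f q.imJ, f q.imK⟩
  map_one' := by ext <;> simp
  map_mul' p q := by ext <;> simp [ha, hb, hc]
  map_zero' := by ext <;> simp
  map_add' p q := by ext <;> simp

/-- The reduction of a quaternion algebra modulo `J`, along a change of scalars that kills `J ^ 2`;
its target is the quadratic algebra generated by `I`. -/
@[simps]
def quaternionModJ (f : R →+* S) (ha : f a = a') (hb : f b = b') (hc : f c = 0) :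
    QuaternionAlgebra R a b c →+* QuadraticAlgebra S a' b' where
  toFun q := ⟨f q.re, f q.imI⟩
  map_one' := by ext <;> simp
  map_mul' p q := by ext <;> simp [ha, hb, hc]
  map_zero' := by ext <;> simp
  map_add' p q := by ext <;> simp

theorem eq_one_of_mem_unitary_of_mem_scalars [IsReduced R] [CharP R 2]
    {q : QuaternionAlgebra R a b c} (hq : q ∈ unitary (QuaternionAlgebra R a b c))
    (hI : q.imI = 0) (hJ : q.imJ = 0) (hK : q.imK = 0) : q = 1 := by
  have hnorm : q.re ^ 2 = 1 := by
    simpa [hI, hJ, hK, sq] using congrArg QuaternionAlgebra.re (Unitary.star_mul_self_of_mem hq)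
  have hre : q.re = 1 := frobenius_inj R 2 (by simpa [frobenius_def] using hnorm)
  ext <;> simp [hre, hI, hJ, hK]

end QuaternionAlgebra

/-- The order `𝔒₁` over an arbitrary base ring, with `t` in the role of `z`. -/
abbrev QuatOrder (R : Type*) [CommRing R] (t : R) : Type _ :=
  QuaternionAlgebra R t 1 (1 + t ^ 3)

section Generators

variable {R : Type*} [CommRing R] [CharP R 2] (t : Rˣ)

/-- The representative `C₁ B₁⁻¹ = 1 + t² + t I + J + I J` of `a₁`. The elements of reduced norm one
are those of `unitary`, because `star` is the quaternion conjugation. -/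
def unitaryA₁ : unitary (QuatOrder R (t : R)) where
  val := ⟨1 + t ^ 2, t, 1, 1⟩
  property := by
    simp only [Unitary.mem_iff, QuaternionAlgebra.star_mk, QuaternionAlgebra.mk_mul_mk,
      QuaternionAlgebra.ext_iff, QuaternionAlgebra.re_one, QuaternionAlgebra.imI_one,
      QuaternionAlgebra.imJ_one, QuaternionAlgebra.imK_one]
    grind

/-- The representative `C₂ B₂⁻¹ = t + t⁻¹ I + t⁻¹ I J` of `a₂`. -/
def unitaryA₂ : unitary (QuatOrder R (t : R)) where
  val := ⟨t, ↑t⁻¹, 0, ↑t⁻¹⟩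
  property := by
    have := t.mul_inv
    simp only [Unitary.mem_iff, QuaternionAlgebra.star_mk, QuaternionAlgebra.mk_mul_mk,
      QuaternionAlgebra.ext_iff, QuaternionAlgebra.re_one, QuaternionAlgebra.imI_one,
      QuaternionAlgebra.imJ_one, QuaternionAlgebra.imK_one]
    grind

theorem coe_unitaryA₁ : (unitaryA₁ t : QuatOrder R t) = ⟨1 + t ^ 2, t, 1, 1⟩ := rfl

theorem coe_unitaryA₂ : (unitaryA₂ t : QuatOrder R t) = ⟨t, ↑t⁻¹, 0, ↑t⁻¹⟩ := rfl

theorem coe_unitaryA₂_sq :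
    (↑(unitaryA₂ t ^ 2) : QuatOrder R t) = ⟨0, ↑t⁻¹ ^ 2, 0, ↑t⁻¹ ^ 2⟩ := by
  have := t.mul_inv
  rw [sq]
  simp only [Submonoid.coe_mul, coe_unitaryA₂, QuaternionAlgebra.mk_mul_mk,
    QuaternionAlgebra.mk.injEq]
  grind

theorem coe_unitaryA₂_mul_unitaryA₁_mul_unitaryA₂ :
    (↑(unitaryA₂ t * unitaryA₁ t * unitaryA₂ t) : QuatOrder R t) =
      ⟨1, t + 1 + ↑t⁻¹, 1, ↑t⁻¹⟩ := by
  have := t.mul_inv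
  simp only [Submonoid.coe_mul, coe_unitaryA₁, coe_unitaryA₂, QuaternionAlgebra.mk_mul_mk,
    QuaternionAlgebra.mk.injEq]
  grind

theorem coe_unitaryA₂_inv_mul_unitaryA₁_sq :
    (↑(((unitaryA₂ t)⁻¹ * unitaryA₁ t) ^ 2) : QuatOrder R t) =
      ⟨t + t ^ 2, t ^ 2, 1 + t, 0⟩ := by
  have := t.mul_inv
  have hcoe : (↑((unitaryA₂ t)⁻¹ * unitaryA₁ t) : QuatOrder R t) =
      ⟨t + 1 + ↑t⁻¹, t, 1 + ↑t⁻¹, 0⟩ := by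
    simp only [← Unitary.star_eq_inv, Submonoid.coe_mul, Unitary.coe_star, coe_unitaryA₁,
      coe_unitaryA₂, QuaternionAlgebra.star_mk, QuaternionAlgebra.mk_mul_mk,
      QuaternionAlgebra.mk.injEq]
    grind
  rw [sq, Submonoid.coe_mul, hcoe, QuaternionAlgebra.mk_mul_mk, QuaternionAlgebra.mk.injEq]
  grind

theorem latticeRelations_unitary : LatticeRelations (unitaryA₁ t) (unitaryA₂ t) where
  relation_one := by
    have := t.mul_inv
    apply Subtype.ext
    rw [Submonoid.coe_mul, Submonoid.coe_mul, Submonoid.coe_mul,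
      coe_unitaryA₂_mul_unitaryA₁_mul_unitaryA₂]
    simp only [← Unitary.star_eq_inv, Submonoid.coe_mul, Unitary.coe_star, coe_unitaryA₂_sq,
      coe_unitaryA₁, coe_unitaryA₂, QuaternionAlgebra.star_mk, QuaternionAlgebra.mk_mul_mk,
      QuaternionAlgebra.mk.injEq]
    grind
  relation_two := by
    have := t.mul_inv
    apply Subtype.ext
    rw [Submonoid.coe_mul, Submonoid.coe_mul, Submonoid.coe_mul, coe_unitaryA₂_inv_mul_unitaryA₁_sq,
      ← Unitary.star_eq_inv, Unitary.coe_star, coe_unitaryA₂_mul_unitaryA₁_mul_unitaryA₂]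
    simp only [← Unitary.star_eq_inv, Submonoid.coe_mul, Unitary.coe_star, coe_unitaryA₂_sq,
      coe_unitaryA₁, coe_unitaryA₂, QuaternionAlgebra.star_mk, QuaternionAlgebra.mk_mul_mk,
      QuaternionAlgebra.mk.injEq]
    grind

end Generators

section Lattice

variable {R : Type*} [CommRing R] [CharP R 2] (t : Rˣ)

/-- The group generated by the representatives of `a₁` and `a₂` of reduced norm one. -/
def normOneLattice : Subgroup (unitary (QuatOrder R (t : R))) :=
  Subgroup.closure {unitaryA₁ t, unitaryA₂ t}

/-- The generator `unitaryA₁ t` of `normOneLattice t`. -/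
def latticeA₁ : normOneLattice t := ⟨unitaryA₁ t, Subgroup.subset_closure (by simp)⟩

/-- The generator `unitaryA₂ t` of `normOneLattice t`. -/
def latticeA₂ : normOneLattice t := ⟨unitaryA₂ t, Subgroup.subset_closure (by simp)⟩

theorem latticeRelations_latticeA : LatticeRelations (latticeA₁ t) (latticeA₂ t) :=
  .of_map (normOneLattice t).subtype_injective (latticeRelations_unitary t)

theorem zpowers_of_latticeA₁_eq_top : Subgroup.zpowers (Abelianization.of (latticeA₁ t)) = ⊤ := by
  have hgen : Subgroup.closure {latticeA₁ t, latticeA₂ t} = ⊤ := closure_pair_subtype_eq_top _ _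
  have hsq : Abelianization.of (latticeA₂ t) = Abelianization.of (latticeA₁ t) ^ 2 :=
    ((latticeRelations_latticeA t).map Abelianization.of).eq_sq
  refine zpowers_of_eq_top_of_closure_pair_eq_top hgen ?_
  rw [hsq]
  exact Subgroup.npow_mem_zpowers _ 2

theorem of_latticeA₁_pow_fifteen : Abelianization.of (latticeA₁ t) ^ 15 = 1 :=
  ((latticeRelations_latticeA t).map Abelianization.of).pow_fifteen_eq_one

variable {t} {S : Type*} [CommRing S] {s : S}

/-- The reduction modulo `J` on elements of reduced norm one, when `t` maps to a cube root of unity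
`s`. -/
def unitaryModJ (f : R →+* S) (hft : f t = s) (hs : 1 + s ^ 3 = 0) :
    unitary (QuatOrder R (t : R)) →* (QuadraticAlgebra S s 1)ˣ :=
  (Units.map (quaternionModJ (c := 1 + (t : R) ^ 3) f hft (map_one f)
    (by rw [map_add, map_one, map_pow, hft, hs])).toMonoidHom).comp Unitary.toUnits

theorem orderOf_dvd_orderOf_latticeA₁ (f : R →+* S) (hft : f t = s) (hs : 1 + s ^ 3 = 0) :
    orderOf (⟨1 + s ^ 2, s⟩ : QuadraticAlgebra S s 1) ∣
      orderOf (Abelianization.of (latticeA₁ t)) := by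
  have hval : (unitaryModJ f hft hs (unitaryA₁ t) : QuadraticAlgebra S s 1) = ⟨1 + s ^ 2, s⟩ := by
    ext <;> simp [unitaryModJ, coe_unitaryA₁, hft]
  rw [← hval, orderOf_units]
  exact orderOf_map_dvd_orderOf_abelianization
    ((unitaryModJ f hft hs).comp (normOneLattice t).subtype) (latticeA₁ t)

end Lattice

/-- The field `𝔽₄ = 𝔽₂[ω]` with `ω ^ 2 = 1 + ω`. -/
abbrev F4 : Type := QuadraticAlgebra (ZMod 2) 1 1

/-- The primitive cube root of unity `ω` of `𝔽₄`, as a unit. -/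
def unitω : F4ˣ where
  val := ⟨0, 1⟩
  inv := ⟨1, 1⟩
  val_inv := by decide
  inv_val := by decide

theorem three_dvd_orderOf_latticeA₁ :
    3 ∣ orderOf (Abelianization.of (latticeA₁ (unitT (ZMod 2)))) := by
  have horder : orderOf (⟨1 + 1 ^ 2, 1⟩ : QuadraticAlgebra (ZMod 2) 1 1) = 3 :=
    orderOf_eq_prime (by decide) (by decide)
  simpa only [horder] using
    orderOf_dvd_orderOf_latticeA₁ (s := 1) (eval₂ (RingHom.id (ZMod 2)) 1) (eval₂_unitT _ _)
      (by decide)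

theorem five_dvd_orderOf_latticeA₁ :
    5 ∣ orderOf (Abelianization.of (latticeA₁ (unitT (ZMod 2)))) := by
  have : Fact (Nat.Prime 5) := ⟨Nat.prime_five⟩
  have horder : orderOf (⟨1 + (unitω : F4) ^ 2, unitω⟩ : QuadraticAlgebra F4 unitω 1) = 5 :=
    orderOf_eq_prime (by decide) (by decide)
  simpa only [horder] using
    orderOf_dvd_orderOf_latticeA₁ (s := (unitω : F4)) (eval₂ (algebraMap (ZMod 2) F4) unitω)
      (eval₂_unitT _ _) (by decide)

theorem orderOf_latticeA₁ :
    orderOf (Abelianization.of (latticeA₁ (unitT (ZMod 2)))) = 15 :=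
  Nat.dvd_antisymm (orderOf_dvd_of_pow_eq_one (of_latticeA₁_pow_fifteen _))
    (Nat.Coprime.mul_dvd_of_dvd_of_dvd (by decide) three_dvd_orderOf_latticeA₁
      five_dvd_orderOf_latticeA₁)

/-- The map from the elements of reduced norm one over `𝔽₂[z, 1 / z]` to `G(R₁)`. -/
noncomputable def unitaryToGR1 :
    unitary (QuatOrder (ZMod 2)[T;T⁻¹] (unitT (ZMod 2))) →* GR1 :=
  (QuotientGroup.mk' scalarUnits).comp <|
    (Units.map (quaternionMap (c := 1 + (unitT (ZMod 2) : (ZMod 2)[T;T⁻¹]) ^ 3) laurentToR1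
      laurentToR1_unitT (map_one _)
      (by rw [map_add, map_one, map_pow, laurentToR1_unitT])).toMonoidHom).comp Unitary.toUnits

theorem unitaryToGR1_injective : Function.Injective unitaryToGR1 := by
  refine (injective_iff_map_eq_one _).2 fun u hu => Subtype.ext ?_
  obtain ⟨r, hr⟩ := (QuotientGroup.eq_one_iff _).1 hu
  have hscalar := congrArg Units.val hr
  refine eq_one_of_mem_unitary_of_mem_scalars u.2 ?_ ?_ ?_ <;> apply laurentToR1_injective
  · simpa [QuaternionAlgebra.algebraMap_eq] using (congrArg QuaternionAlgebra.imI hscalar).symm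
  · simpa [QuaternionAlgebra.algebraMap_eq] using (congrArg QuaternionAlgebra.imJ hscalar).symm
  · simpa [QuaternionAlgebra.algebraMap_eq] using (congrArg QuaternionAlgebra.imK hscalar).symm

theorem C1_eq_mk : C1 = ⟨1 + z ^ 2, 0, 0, 1⟩ := by
  ext <;> simp [C1, I, J, QuaternionAlgebra.algebraMap_eq]

theorem C2_eq_mk : C2 = ⟨z + z ^ 2, 0, 0, 1⟩ := by
  ext <;> simp [C2, I, J, QuaternionAlgebra.algebraMap_eq]

theorem B1_eq_mk : B1 = ⟨0, 1 + z, 1, 0⟩ := by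
  ext <;> simp [B1, I, J]

theorem B2_eq_mk : B2 = ⟨z + z ^ 2, 1 + z, 1, 1⟩ := by
  ext <;> simp [B2, I, J, QuaternionAlgebra.algebraMap_eq]

theorem unitaryToGR1_unitaryA₁ : unitaryToGR1 (unitaryA₁ _) = c1 * b1⁻¹ := by
  rw [eq_mul_inv_iff_mul_eq]
  refine congrArg (QuotientGroup.mk (s := scalarUnits)) (Units.ext ?_)
  change (⟨_, _, _, _⟩ : O1) * B1 = C1
  simp only [Unitary.val_toUnits_apply, coe_unitaryA₁, map_add, map_one, map_pow, laurentToR1_unitT,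
    B1_eq_mk, C1_eq_mk, QuaternionAlgebra.mk_mul_mk, QuaternionAlgebra.mk.injEq]
  grind

theorem unitaryToGR1_unitaryA₂ : unitaryToGR1 (unitaryA₂ _) = c2 * b2⁻¹ := by
  have hz : z * laurentToR1 ↑(unitT (ZMod 2))⁻¹ = 1 := by
    rw [← laurentToR1_unitT, ← map_mul, Units.mul_inv, map_one]
  rw [eq_mul_inv_iff_mul_eq]
  refine congrArg (QuotientGroup.mk (s := scalarUnits)) (Units.ext ?_)
  change (⟨_, _, _, _⟩ : O1) * B2 = C2
  simp only [Unitary.val_toUnits_apply, coe_unitaryA₂, map_zero, laurentToR1_unitT, B2_eq_mk,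
    C2_eq_mk, QuaternionAlgebra.mk_mul_mk, QuaternionAlgebra.mk.injEq]
  grind

theorem map_normOneLattice : (normOneLattice (unitT (ZMod 2))).map unitaryToGR1 = Gam := by
  rw [normOneLattice, MonoidHom.map_closure, Set.image_pair, unitaryToGR1_unitaryA₁,
    unitaryToGR1_unitaryA₂, Gam]

/-- The isomorphism from `Γ` to the group generated by the representatives of reduced norm one. -/
noncomputable def gamEquiv : Gam ≃* normOneLattice (unitT (ZMod 2)) :=
  (MulEquiv.subgroupCongr map_normOneLattice.symm).trans
    ((normOneLattice _).equivMapOfInjective unitaryToGR1 unitaryToGR1_injective).symm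

end QuatLattice

theorem mainTheorem9 :
    Nonempty (Abelianization QuatLattice.Gam ≃* Multiplicative (ZMod 15)) := by
  have hgen := QuatLattice.zpowers_of_latticeA₁_eq_top (QuatLattice.unitT (ZMod 2))
  have hcard := (orderOf_eq_card_of_zpowers_eq_top hgen).symm.trans QuatLattice.orderOf_latticeA₁
  exact ⟨QuatLattice.gamEquiv.abelianizationCongr.trans
    (zmodMulEquivOfGenerator (fun q => hgen ▸ Subgroup.mem_top q) hcard).symm⟩
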